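/- Let $\mathbb{F}$ be a field, let $\mathfrak{g}$ be a Lie algebra over $\mathbb{F}$ (of arbitrary dimension), and let $M$ be a left $\mathfrak{g}$-module (of arbitrary dimension). Let $\mathrm{H}^\bullet(\mathfrak{g},M)$ denote the Chevalley–Eilenberg cohomology, i.e. the cohomology of the complex of alternating multilinear maps $f:\mathfrak{g}^n\to M$ with coboundary $$(df)(x_1,\dots,x_{n+1})=\sum_{i=1}^{n+1}(-1)^{i+1}x_i\cdot f(x_1,\dots,\hat x_i,\dots,x_{n+1})+\sum_{1\le i<j\le n+1}(-1)^{i+j}f([x_i,x_j],x_1,\dots,\hat x_i,\dots,\hat x_j,\dots,x_{n+1}).$$ Regard $\mathfrak{g}$ as a left Leibniz algebra with product $xy:=[x,y]$, and let $M_s$ be the symmetric Leibniz $\mathfrak{g}$-bimodule with underlying left module $M$ and right action $m\cdot x:=-x\cdot m$. Let $\mathrm{HL}^\bullet(\mathfrak{g},M_s)$ denote the Leibniz cohomology, i.e. the cohomology of the complex of all multilinear maps $f:\mathfrak{g}^n\to M$ with coboundary $$(df)(x_1,\dots,x_{n+1})=\sum_{i=1}^{n}(-1)^{i+1}x_i\cdot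 f(x_1,\dots,\hat x_i,\dots,x_{n+1})+(-1)^{n+1}f(x_1,\dots,x_n)\cdot x_{n+1}+\sum_{1\le i<j\le n+1}(-1)^{i}f(x_1,\dots,\hat x_i,\dots,x_ix_j,\dots,x_{n+1}),$$ where $x_ix_j$ stands in the position of $x_j$. Theorem. Let $n$ be a non-negative integer. If $\mathrm{H}^k(\mathfrak{g},M)=0$ for every integer $k$ with $0\le k\le n$, then $\mathrm{HL}^k(\mathfrak{g},M_s)=0$ for every integer $k$ with $0\le k\le n$, and there are isomorphisms of $\mathbb{F}$-vector spaces $$\mathrm{HL}^{n+1}(\mathfrak{g},M_s)\cong\mathrm{H}^{n+1}(\mathfrak{g},M)\quad\text{and}\quad\mathrm{HL}^{n+2}(\mathfrak{g},M_s)\cong\mathrm{H}^{n+2}(\mathfrak{g},M).$$ In particular, if $\mathrm{H}^k(\mathfrak{g},M)=0$ for every integer $k\ge 0$, then $\mathrm{HL}^k(\mathfrak{g},M_s)=0$ for every integer $k\ge 0$. -/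

import Mathlib

namespace LeibnizCoh

/-! ### Left Leibniz algebras and their bimodules -/

/-- A left Leibniz algebra structure on the vector space `L`: a bilinear product all of whose left
multiplications are derivations. -/
structure LeftLeibnizAlgebra (F L : Type*) [Field F] [AddCommGroup L] [Module F L] where
  mul : L →ₗ[F] L →ₗ[F] L
  leibniz : ∀ x y z, mul x (mul y z) = mul (mul x y) z + mul y (mul x z)

/-- A bimodule structure on `M` over a left Leibniz algebra: `left x m` is `x · m` and
`right m x` is `m · x`. -/
structure LeibnizBimodule {F L : Type*} [Field F] [AddCommGroup L] [Module F L]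
    (A : LeftLeibnizAlgebra F L) (M : Type*) [AddCommGroup M] [Module F M] where
  left : L →ₗ[F] M →ₗ[F] M
  right : M →ₗ[F] L →ₗ[F] M
  left_mul : ∀ x y m, left (A.mul x y) m = left x (left y m) - left y (left x m)
  left_right : ∀ x y m, right (left x m) y = left x (right m y) - right m (A.mul x y)
  right_right : ∀ x y m, right (right m x) y = right m (A.mul x y) - left x (right m y)

/-- A Lie algebra, regarded as a left Leibniz algebra. -/
def lieLeibniz (F g : Type*) [Field F] [LieRing g] [LieAlgebra F g] :
    LeftLeibnizAlgebra F g where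
  mul := (LieModule.toEnd F g g : g →ₗ[F] Module.End F g)
  leibniz x y z := leibniz_lie x y z

/-- The symmetric Leibniz bimodule `M_s` of a left module `M` over a Lie algebra:
`m · x = -(x · m)`. -/
def symmBimodule (F g M : Type*) [Field F] [LieRing g] [LieAlgebra F g]
    [AddCommGroup M] [Module F M] [LieRingModule g M] [LieModule F g M] :
    LeibnizBimodule (lieLeibniz F g) M where
  left := (LieModule.toEnd F g M : g →ₗ[F] Module.End F M)
  right := -(LieModule.toEnd F g M : g →ₗ[F] Module.End F M).flip
  left_mul x y m := lie_lie x y m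
  left_right x y m := by
    simp only [lieLeibniz, LinearMap.neg_apply, LinearMap.flip_apply, LieHom.coe_toLinearMap,
      LieModule.toEnd_apply_apply, lie_lie, lie_neg]
    abel
  right_right x y m := by
    simp only [lieLeibniz, LinearMap.neg_apply, LinearMap.flip_apply, LieHom.coe_toLinearMap,
      LieModule.toEnd_apply_apply, lie_lie, lie_neg]
    abel

/-! ### Cohomology of a sequence of linear maps -/

section Cohomology

variable {F : Type*} [Field F] {C : ℕ → Type*} [∀ n, AddCommGroup (C n)] [∀ n, Module F (C n)]

/-- Coboundaries in degree `n`: the image of `d (n - 1)`, which is `0` for `n = 0`. -/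
def coboundaries (d : ∀ n, C n →ₗ[F] C (n + 1)) : ∀ n, Submodule F (C n)
  | 0 => ⊥
  | n + 1 => LinearMap.range (d n)

/-- Cohomology in degree `n`: the quotient of `ker (d n)` by the coboundaries of degree `n`. -/
abbrev Cohomology (d : ∀ n, C n →ₗ[F] C (n + 1)) (n : ℕ) : Type _ :=
  LinearMap.ker (d n) ⧸ (coboundaries d n).submoduleOf (LinearMap.ker (d n))

end Cohomology

/-! ### Leibniz cohomology -/

section Leibniz

variable {F L M : Type*} [Field F] [AddCommGroup L] [Module F L] [AddCommGroup M] [Module F M]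

/-- Leibniz cochains: `n`-linear maps `L × ⋯ × L → M`, i.e. linear maps `L^{⊗ n} → M`. -/
abbrev CL (F L M : Type*) [Field F] [AddCommGroup L] [Module F L] [AddCommGroup M] [Module F M]
    (n : ℕ) : Type _ :=
  MultilinearMap F (fun _ : Fin n => L) M

/-- The formula of the Leibniz coboundary. The arguments are indexed from `0`, so that the signs
`(-1)^(i+1)` and `(-1)^i` of the usual formula become `(-1)^i` and `(-1)^(i+1)`. In the last sum
the `i`-th argument is omitted and the product `x_i x_j` replaces `x_j`. -/
def dLeibnizFun {A : LeftLeibnizAlgebra F L} (B : LeibnizBimodule A M) {n : ℕ} (f : CL F L M n)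
    (x : Fin (n + 1) → L) : M :=
  (∑ i : Fin n, (-1 : ℤ) ^ (i : ℕ) • B.left (x i.castSucc) (f (i.castSucc.removeNth x)))
    + (-1 : ℤ) ^ (n + 1) • B.right (f ((Fin.last n).removeNth x)) (x (Fin.last n))
    + ∑ i : Fin (n + 1), ∑ j ∈ Finset.Ioi i, (-1 : ℤ) ^ ((i : ℕ) + 1) •
        f (i.removeNth (Function.update x j (A.mul (x i) (x j))))

/-- Inserting the value of a bilinear expression `b (x p) (f (x without x p))` is multilinear. -/
lemma exists_multilinear_insert {n : ℕ} (b : L →ₗ[F] M →ₗ[F] M) (f : CL F L M n)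
    (p : Fin (n + 1)) :
    ∃ G : CL F L M (n + 1), ∀ x, G x = b (x p) (f (p.removeNth x)) := by
  refine ⟨LinearMap.uncurryMid p
    { toFun := fun y => (b y).compMultilinearMap f
      map_add' := fun y z => by ext; simp
      map_smul' := fun c y => by ext; simp }, fun x => by simp⟩

lemma exists_multilinear_mul {n : ℕ} (b : L →ₗ[F] L →ₗ[F] L) (f : CL F L M n)
    (i j : Fin (n + 1)) (hij : i < j) :
    ∃ G : CL F L M (n + 1), ∀ x,
      G x = f (i.removeNth (Function.update x j (b (x i) (x j)))) := by
  obtain ⟨k, rfl⟩ := Fin.exists_succAbove_eq (ne_of_gt hij)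
  have key : ∀ (y : L) (w : Fin n → L),
      f.compLinearMap (Function.update (fun _ => LinearMap.id) k (b y)) w
        = f (Function.update w k (b y (w k))) := by
    intro y w
    rw [MultilinearMap.compLinearMap_apply]
    congr 1
    funext l
    by_cases h : l = k
    · subst h; simp
    · simp [h]
  refine ⟨LinearMap.uncurryMid i
    { toFun := fun y => f.compLinearMap (Function.update (fun _ => LinearMap.id) k (b y))
      map_add' := fun y z => by
        ext w
        rw [add_apply, key, key, key]
        simp
      map_smul' := fun c y => by
        ext w
        rw [RingHom.id_apply, smul_apply, key, key]
        simp }, fun x => ?_⟩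
  rw [Fin.removeNth_update_succAbove]
  simp only [LinearMap.uncurryMid_apply, LinearMap.coe_mk, AddHom.coe_mk, key]
  rfl

lemma exists_multilinear_dLeibniz {A : LeftLeibnizAlgebra F L} (B : LeibnizBimodule A M) {n : ℕ}
    (f : CL F L M n) : ∃ G : CL F L M (n + 1), ∀ x, G x = dLeibnizFun B f x := by
  choose G₁ h₁ using fun i : Fin n => exists_multilinear_insert B.left f i.castSucc
  obtain ⟨G₂, h₂⟩ := exists_multilinear_insert B.right.flip f (Fin.last n)
  choose G₃ h₃ using fun i j : Fin (n + 1) => fun h : i < j => exists_multilinear_mul A.mul f i j h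
  refine ⟨(∑ i : Fin n, (-1 : ℤ) ^ (i : ℕ) • G₁ i) + (-1 : ℤ) ^ (n + 1) • G₂
    + ∑ i : Fin (n + 1), ∑ j ∈ (Finset.Ioi i).attach, (-1 : ℤ) ^ ((i : ℕ) + 1) •
        G₃ i j.1 (Finset.mem_Ioi.1 j.2), fun x => ?_⟩
  simp only [add_apply, sum_apply, smul_apply,
    h₁, h₂, h₃, dLeibnizFun, LinearMap.flip_apply]
  congr 1
  refine Finset.sum_congr rfl fun i _ => ?_
  exact Finset.sum_attach (Finset.Ioi i) (fun j => (-1 : ℤ) ^ ((i : ℕ) + 1) •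
    f (i.removeNth (Function.update x j (A.mul (x i) (x j)))))

/-- The Leibniz coboundary `d^n : CL^n(L, M) → CL^{n+1}(L, M)`. -/
def dLeibniz {A : LeftLeibnizAlgebra F L} (B : LeibnizBimodule A M) (n : ℕ) :
    CL F L M n →ₗ[F] CL F L M (n + 1) where
  toFun f :=
    { toFun := dLeibnizFun B f
      map_update_add' := fun m i x y => by
        obtain ⟨G, hG⟩ := exists_multilinear_dLeibniz B f
        simp only [← hG, MultilinearMap.map_update_add]
      map_update_smul' := fun m i c x => by
        obtain ⟨G, hG⟩ := exists_multilinear_dLeibniz B f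
        simp only [← hG, MultilinearMap.map_update_smul] }
  map_add' f f' := by
    ext x
    simp only [MultilinearMap.coe_mk, add_apply, dLeibnizFun, map_add,
      LinearMap.add_apply, smul_add, Finset.sum_add_distrib]
    abel
  map_smul' c f := by
    ext x
    simp only [MultilinearMap.coe_mk, smul_apply, dLeibnizFun, map_smul,
      LinearMap.smul_apply, RingHom.id_apply, smul_add, Finset.smul_sum, smul_comm c]

/-- Leibniz cohomology `HL^n(L, M)` of a left Leibniz algebra with coefficients in a bimodule. -/
abbrev HL {A : LeftLeibnizAlgebra F L} (B : LeibnizBimodule A M) (n : ℕ) : Type _ :=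
  Cohomology (dLeibniz B) n

end Leibniz

/-! ### Chevalley–Eilenberg cohomology -/

section ChevalleyEilenberg

variable {F g M : Type*} [Field F] [LieRing g] [LieAlgebra F g]
  [AddCommGroup M] [Module F M]

/-- Chevalley–Eilenberg cochains: alternating `n`-linear maps `g × ⋯ × g → M`, i.e. linear maps
`Λ^n g → M`. -/
abbrev CE (F g M : Type*) [Field F] [LieRing g] [LieAlgebra F g] [AddCommGroup M] [Module F M]
    (n : ℕ) : Type _ :=
  g [⋀^Fin n]→ₗ[F] M

/-- The bracket part `∑_{i<j} (-1)^(i+j) f([x_i, x_j], x_1, …, x̂_i, …, x̂_j, …, x_{n+1})` of the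
Chevalley–Eilenberg coboundary of a cochain of degree at least `1` (it is an empty sum in
degree `0`). A pair of positions is encoded as `i.castSucc < j.succ` with `i ≤ j`; after the
omission of the former position, the latter one is `j`. -/
def ceBracket : ∀ {n : ℕ}, CE F g M n → (Fin (n + 1) → g) → M
  | 0, _, _ => 0
  | n + 1, f, x => ∑ i : Fin (n + 1), ∑ j ∈ Finset.Ici i, (-1 : ℤ) ^ ((i : ℕ) + (j : ℕ) + 1) •
      f (Fin.cons ⁅x i.castSucc, x j.succ⁆ (j.removeNth (i.castSucc.removeNth x)))

/-- The summand of `ceBracket` belonging to the positions `i` and `j`, with the bracket put in the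
place of the `j`-th argument. -/
def ceTerm {n : ℕ} (f : CE F g M n) (x : Fin (n + 1) → g) (i j : Fin (n + 1)) : M :=
  (-1 : ℤ) ^ ((i : ℕ) + 1) • f (i.removeNth (Function.update x j ⁅x i, x j⁆))

lemma ceBracket_eq {n : ℕ} (f : CE F g M n) (x : Fin (n + 1) → g) :
    ceBracket f x = ∑ i : Fin (n + 1), ∑ j ∈ Finset.Ioi i, ceTerm f x i j := by
  cases n with
  | zero => simp [ceBracket]
  | succ n =>
    rw [Fin.sum_univ_castSucc]
    have hlast : Finset.Ioi (Fin.last (n + 1)) = ∅ := by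
      ext j; simp [Fin.le_last]
    rw [hlast, Finset.sum_empty, add_zero]
    simp only [ceBracket]
    refine Finset.sum_congr rfl fun i _ => ?_
    have hI : Finset.Ioi i.castSucc = (Finset.Ici i).map (Fin.succEmb (n + 1)) := by
      rw [Fin.map_succEmb_Ici]
      ext j
      simp [Fin.castSucc_lt_iff_succ_le]
    rw [hI, Finset.sum_map]
    refine Finset.sum_congr rfl fun j hj => ?_
    rw [Finset.mem_Ici] at hj
    have hs : i.castSucc.succAbove j = j.succ := Fin.succAbove_castSucc_of_le _ _ hj
    rw [ceTerm, Fin.coe_succEmb, ← hs, Fin.removeNth_update_succAbove, ← Fin.insertNth_removeNth,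
      AlternatingMap.map_insertNth, smul_smul, ← pow_add]
    congr 2
    simp only [Fin.val_castSucc]
    ring

lemma removeNth_update_add {n : ℕ} (f : CE F g M n) (x : Fin (n + 1) → g) (z : g)
    {i j : Fin (n + 1)} (hij : i ≠ j) :
    (-1 : ℤ) ^ (i : ℕ) • f (i.removeNth (Function.update x j z))
      + (-1 : ℤ) ^ (j : ℕ) • f (j.removeNth (Function.update x i z)) = 0 := by
  have h := f.neg_one_pow_smul_map_removeNth_add_eq_zero_of_eq
    (v := Function.update (Function.update x i z) j z) (i := i) (j := j) (by simp [hij]) hij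
  rw [Fin.removeNth_update j, Function.update_comm hij, Fin.removeNth_update i] at h
  exact h

lemma ceTerm_comm {n : ℕ} (f : CE F g M n) (x : Fin (n + 1) → g) (i j : Fin (n + 1)) :
    ceTerm f x i j = ceTerm f x j i := by
  rcases eq_or_ne i j with rfl | hij
  · rfl
  have h := removeNth_update_add f x ⁅x i, x j⁆ hij
  obtain ⟨k, hk⟩ := Fin.exists_succAbove_eq hij
  have hneg : f (j.removeNth (Function.update x i ⁅x j, x i⁆))
      = - f (j.removeNth (Function.update x i ⁅x i, x j⁆)) := by
    rw [← lie_skew, ← hk, Fin.removeNth_update_succAbove, Fin.removeNth_update_succAbove,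
      AlternatingMap.map_update_neg]
  rw [ceTerm, ceTerm, hneg, pow_succ, pow_succ, mul_neg_one, mul_neg_one, neg_smul, neg_smul,
    smul_neg, neg_neg, neg_eq_iff_add_eq_zero]
  exact h

lemma ceTerm_add_eq_zero {n : ℕ} (f : CE F g M n) (x : Fin (n + 1) → g) {a b k : Fin (n + 1)}
    (hx : x a = x b) (hab : a ≠ b) (hka : k ≠ a) (hkb : k ≠ b) :
    ceTerm f x a k + ceTerm f x b k = 0 := by
  have h := f.neg_one_pow_smul_map_removeNth_add_eq_zero_of_eq
    (v := Function.update x k ⁅x a, x k⁆) (i := a) (j := b)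
    (by simp [Function.update_of_ne hka.symm, Function.update_of_ne hkb.symm, hx]) hab
  rw [ceTerm, ceTerm, ← hx, pow_succ, pow_succ, mul_neg_one, mul_neg_one, neg_smul, neg_smul,
    ← neg_add, h, neg_zero]

lemma ceTerm_eq_zero {n : ℕ} (f : CE F g M n) (x : Fin (n + 1) → g) {a b i j : Fin (n + 1)}
    (hx : x a = x b) (hab : a ≠ b) (hia : i ≠ a) (hib : i ≠ b) (hja : j ≠ a) (hjb : j ≠ b) :
    ceTerm f x i j = 0 := by
  obtain ⟨a', rfl⟩ := Fin.exists_succAbove_eq hia.symm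
  obtain ⟨b', rfl⟩ := Fin.exists_succAbove_eq hib.symm
  rw [ceTerm, f.map_eq_zero_of_eq (i := a') (j := b'), smul_zero]
  · simp [Fin.removeNth_apply, Function.update_of_ne hja.symm, Function.update_of_ne hjb.symm, hx]
  · rintro rfl
    exact hab rfl

lemma ceTerm_self {n : ℕ} (f : CE F g M n) (x : Fin (n + 1) → g) {a b : Fin (n + 1)}
    (hx : x a = x b) (hab : a ≠ b) : ceTerm f x a b = 0 := by
  obtain ⟨k, rfl⟩ := Fin.exists_succAbove_eq hab.symm
  rw [ceTerm, Fin.removeNth_update_succAbove, hx, lie_self, AlternatingMap.map_update_zero,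
    smul_zero]

lemma ceBracket_eq_zero {n : ℕ} (f : CE F g M n) (x : Fin (n + 1) → g) {a b : Fin (n + 1)}
    (hx : x a = x b) (hab : a ≠ b) : ceBracket f x = 0 := by
  let T : Sym2 (Fin (n + 1)) → M :=
    Sym2.lift ⟨fun i j => ceTerm f x i j, fun i j => ceTerm_comm f x i j⟩
  have hT : ∀ i j, T s(i, j) = ceTerm f x i j := fun i j => rfl
  have hsum : ceBracket f x
      = ∑ e ∈ (Finset.univ : Finset (Fin (n + 1))).sym2 with ¬ e.IsDiag, T e := by
    rw [ceBracket_eq, Finset.sum_sym2_filter_not_isDiag, Finset.sum_sigma']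
    refine Finset.sum_bij' (fun p _ => (p.1, p.2)) (fun p _ => ⟨p.1, p.2⟩) ?_ ?_ ?_ ?_ ?_
    · rintro ⟨i, j⟩ h
      simp only [Finset.mem_sigma, Finset.mem_univ, Finset.mem_Ioi, true_and] at h
      simp [h, h.ne]
    · rintro ⟨i, j⟩ h
      simp only [Finset.mem_filter] at h
      simpa using h.2
    · simp
    · simp
    · simp [hT]
  rw [hsum]
  have hσ : ∀ e : Sym2 (Fin (n + 1)),
      Sym2.map (Equiv.swap a b) (Sym2.map (Equiv.swap a b) e) = e := by
    intro e
    rw [Sym2.map_map]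
    have : (Equiv.swap a b : Fin (n + 1) → Fin (n + 1)) ∘ Equiv.swap a b = id := by
      funext i; simp
    rw [this, Sym2.map_id, id]
  have hadd : ∀ e : Sym2 (Fin (n + 1)), ¬ e.IsDiag →
      (T e + T (Sym2.map (Equiv.swap a b) e) = 0 ∧
        (T e ≠ 0 → Sym2.map (Equiv.swap a b) e ≠ e)) := by
    intro e
    induction e using Sym2.ind with
    | _ i j =>
      intro hne
      rw [Sym2.mk_isDiag_iff] at hne
      rw [Sym2.map_mk, hT, hT]
      have main : ∀ i j : Fin (n + 1), i ≠ j → (i = a ∨ i = b) →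
          (ceTerm f x i j + ceTerm f x (Equiv.swap a b i) (Equiv.swap a b j) = 0 ∧
            (ceTerm f x i j ≠ 0 → s(Equiv.swap a b i, Equiv.swap a b j) ≠ s(i, j))) := by
        rintro i j hij (rfl | rfl)
        · by_cases hj : j = b
          · subst hj
            simp [ceTerm_self f x hx hab, ceTerm_self f x hx.symm hab.symm]
          · rw [Equiv.swap_apply_left, Equiv.swap_apply_of_ne_of_ne hij.symm hj]
            refine ⟨ceTerm_add_eq_zero f x hx hab hij.symm hj, fun _ h => ?_⟩
            rw [Sym2.congr_left] at h
            exact hab h.symm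
        · by_cases hj : j = a
          · subst hj
            simp [ceTerm_self f x hx hab, ceTerm_self f x hx.symm hab.symm]
          · rw [Equiv.swap_apply_right, Equiv.swap_apply_of_ne_of_ne hj hij.symm]
            refine ⟨ceTerm_add_eq_zero f x hx.symm hab.symm hij.symm hj, fun _ h => ?_⟩
            rw [Sym2.congr_left] at h
            exact hab h
      by_cases hi : i = a ∨ i = b
      · exact main i j hne hi
      by_cases hj : j = a ∨ j = b
      · rw [ceTerm_comm f x i j, ceTerm_comm f x (Equiv.swap a b i), Sym2.eq_swap (a := i),
          Sym2.eq_swap (a := Equiv.swap a b i)]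
        exact main j i (Ne.symm hne) hj
      rw [not_or] at hi hj
      rw [Equiv.swap_apply_of_ne_of_ne hi.1 hi.2, Equiv.swap_apply_of_ne_of_ne hj.1 hj.2,
        ceTerm_eq_zero f x hx hab hi.1 hi.2 hj.1 hj.2]
      simp
  refine Finset.sum_involution (fun e _ => Sym2.map (Equiv.swap a b) e) ?_ ?_ ?_ ?_
  · intro e he
    exact (hadd e (Finset.mem_filter.1 he).2).1
  · intro e he
    exact (hadd e (Finset.mem_filter.1 he).2).2
  · intro e he
    have hd := (Finset.mem_filter.1 he).2
    rw [Finset.mem_filter]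
    refine ⟨by simp, ?_⟩
    rwa [Sym2.isDiag_map (Equiv.swap a b).injective]
  · intro e _
    exact hσ e

variable [LieRingModule g M]

/-- The action part `∑ i, (-1)^(i+1) x_i · f(x_1, …, x̂_i, …, x_{n+1})` of the
Chevalley–Eilenberg coboundary, with arguments indexed from `0`. -/
def ceAction {n : ℕ} (f : CE F g M n) (x : Fin (n + 1) → g) : M :=
  ∑ i : Fin (n + 1), (-1 : ℤ) ^ (i : ℕ) • ⁅x i, f (i.removeNth x)⁆

lemma ceAction_eq_zero {n : ℕ} (f : CE F g M n) (x : Fin (n + 1) → g) {a b : Fin (n + 1)}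
    (hx : x a = x b) (hab : a ≠ b) : ceAction f x = 0 := by
  rw [ceAction, Fintype.sum_eq_add a b hab]
  · have h := f.neg_one_pow_smul_map_removeNth_add_eq_zero_of_eq hx hab
    rw [← hx, ← lie_zsmul, ← lie_zsmul, ← lie_add, h, lie_zero]
  · rintro k ⟨hka, hkb⟩
    obtain ⟨a', rfl⟩ := Fin.exists_succAbove_eq hka.symm
    obtain ⟨b', rfl⟩ := Fin.exists_succAbove_eq hkb.symm
    rw [f.map_eq_zero_of_eq (i := a') (j := b'), lie_zero, smul_zero]
    · exact hx
    · rintro rfl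
      exact hab rfl

/-- The formula of the Chevalley–Eilenberg coboundary. -/
def dCEFun {n : ℕ} (f : CE F g M n) (x : Fin (n + 1) → g) : M :=
  ceAction f x + ceBracket f x

variable [LieModule F g M]

lemma exists_multilinear_dCE {n : ℕ} (f : CE F g M n) :
    ∃ G : CL F g M (n + 1), ∀ x, G x = dCEFun f x := by
  choose G₁ h₁ using fun i : Fin (n + 1) => exists_multilinear_insert
    (LieModule.toEnd F g M : g →ₗ[F] Module.End F M) f.toMultilinearMap i
  choose G₃ h₃ using fun i j : Fin (n + 1) => fun h : i < j => exists_multilinear_mul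
    (LieModule.toEnd F g g : g →ₗ[F] Module.End F g) f.toMultilinearMap i j h
  refine ⟨(∑ i : Fin (n + 1), (-1 : ℤ) ^ (i : ℕ) • G₁ i)
    + ∑ i : Fin (n + 1), ∑ j ∈ (Finset.Ioi i).attach, (-1 : ℤ) ^ ((i : ℕ) + 1) •
        G₃ i j.1 (Finset.mem_Ioi.1 j.2), fun x => ?_⟩
  simp only [add_apply, sum_apply, smul_apply, h₁, h₃, dCEFun, ceAction, ceBracket_eq]
  congr 1
  refine Finset.sum_congr rfl fun i _ => ?_
  exact Finset.sum_attach (Finset.Ioi i) (fun j => ceTerm f x i j)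

/-- The Chevalley–Eilenberg coboundary `C^n(g, M) → C^{n+1}(g, M)`. -/
def dCE (F g M : Type*) [Field F] [LieRing g] [LieAlgebra F g]
    [AddCommGroup M] [Module F M] [LieRingModule g M] [LieModule F g M] (n : ℕ) :
    CE F g M n →ₗ[F] CE F g M (n + 1) where
  toFun f :=
    { toFun := dCEFun f
      map_update_add' := fun m i x y => by
        obtain ⟨G, hG⟩ := exists_multilinear_dCE f
        simp only [← hG, MultilinearMap.map_update_add]
      map_update_smul' := fun m i c x => by
        obtain ⟨G, hG⟩ := exists_multilinear_dCE f
        simp only [← hG, MultilinearMap.map_update_smul]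
      map_eq_zero_of_eq' := fun x a b hx hab => by
        change ceAction f x + ceBracket f x = 0
        rw [ceAction_eq_zero f x hx hab, ceBracket_eq_zero f x hx hab, add_zero] }
  map_add' f f' := by
    ext x
    change dCEFun (f + f') x = dCEFun f x + dCEFun f' x
    simp only [dCEFun, ceAction, ceBracket_eq, ceTerm, AlternatingMap.add_apply, lie_add,
      smul_add, Finset.sum_add_distrib]
    abel
  map_smul' c f := by
    ext x
    change dCEFun (c • f) x = c • dCEFun f x
    simp only [dCEFun, ceAction, ceBracket_eq, ceTerm, AlternatingMap.smul_apply, lie_smul,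
      smul_add, Finset.smul_sum, smul_comm c]

/-- Chevalley–Eilenberg cohomology `H^n(g, M)`. -/
abbrev H (F g M : Type*) [Field F] [LieRing g] [LieAlgebra F g]
    [AddCommGroup M] [Module F M] [LieRingModule g M] [LieModule F g M] (n : ℕ) : Type _ :=
  Cohomology (dCE F g M) n

end ChevalleyEilenberg

end LeibnizCoh

/-!
The Leibniz complex `CL` of `M_s` contains the Chevalley–Eilenberg complex as the subcomplex of
alternating cochains. The theorem follows from the vanishing of the cohomology of the quotient: if
`HL^q(g, M_s) = 0` for all `q ≤ n`, then the quotient has no cohomology in degrees `≤ n + 2`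
(`cokerAcyclicAt_ceIncl`), hence `H^m(g, M) → HL^m(g, M_s)` is surjective for `m ≤ n + 2` and
injective for `m ≤ n + 3`. Starting from no information, this gives inductively `HL^k = 0` for
`k ≤ n` if `H^k = 0` for `k ≤ n`, and then the two isomorphisms.

The quotient is treated by passing through the cochains `f` that are alternating in their first `p`
arguments (this is the filtration behind Pirashvili's spectral sequence). Let `f` be such a cochain,
`p ≥ 1`, whose coboundary is alternating in the first `p + 1` arguments. Write `i_x` for the
insertion of `x` as first argument and `L_x` for the Lie derivative. Cartan's formula `i_x d + d i_x
= L_x` (`ins_dSymm`), together with `L_x i_x = i_x L_x`, gives `i_x i_x d = d i_x i_x`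
(`ins_ins_dSymm`). Consequently `f(x_1, …, x_p, x_p, …)`, as a function of the remaining `q`
arguments, is a cocycle; for `p > 1` the further arguments are moved past `d` by Cartan's formula,
whose Lie derivatives preserve alternation (`IsAltFirst.lieDer`). If `HL^q = 0`, there is a linear
map `s` with `d (s z) = z` for all cocycles `z`; as `F` is a field, it may be taken to be defined on
all cochains. Application of `s` to the tail of `f` behind the first `p + 1` arguments yields a
cochain `h` for which `f ∓ d h` is alternating in the first `p + 1` arguments
(`isAltFirst_succ_sub`). Iteration makes `f` alternating in all its arguments, and as `p ≥ 1`, only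
degrees `q ≤ m - 2` are used for a cochain of degree `m`.
-/

namespace LeibnizCoh

/-! ### Insertion of arguments and partially alternating cochains -/

section Insertion

variable {F L M : Type*} [Field F] [AddCommGroup L] [Module F L] [AddCommGroup M] [Module F M]

/-- Insertion of `x` as the first argument, `f ↦ f (x, …)`. -/
def ins {n : ℕ} (x : L) : CL F L M (n + 1) →ₗ[F] CL F L M n where
  toFun f := f.curryLeft x
  map_add' _ _ := rfl
  map_smul' _ _ := rfl

lemma ins_apply {n : ℕ} (x : L) (f : CL F L M (n + 1)) (v : Fin n → L) :
    ins x f v = f (Fin.cons x v) := rfl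

lemma ins_add_left {n : ℕ} (x y : L) (f : CL F L M (n + 1)) :
    ins (x + y) f = ins x f + ins y f := f.curryLeft.map_add x y

lemma ins_sub_left {n : ℕ} (x y : L) (f : CL F L M (n + 1)) :
    ins (x - y) f = ins x f - ins y f := f.curryLeft.map_sub x y

lemma ext_ins {n : ℕ} {f f' : CL F L M (n + 1)} (h : ∀ x, ins x f = ins x f') : f = f' := by
  ext v
  rw [← Fin.cons_self_tail v, ← ins_apply, h, ins_apply]

/-- A cochain vanishing on `(x, x, …)` is antisymmetric in its first two arguments. -/
lemma ins_ins_swap {n : ℕ} {f : CL F L M (n + 2)} (h : ∀ x, ins x (ins x f) = 0) (x y : L) :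
    ins x (ins y f) + ins y (ins x f) = 0 := by
  have := h (x + y)
  simpa only [ins_add_left, map_add, h, zero_add, add_zero, add_comm] using this

/-- The operator on cochains that applies `φ` to all but the first `k` arguments: the value at
`x_1, …, x_k` followed by a tail `v` is `φ (f (x_1, …, x_k, …)) v`. The degrees are written
`a + k + 1` and `a + k` so that the recursion on `k` needs no casts, and
`ins x (tailMap φ (k + 1) f) = tailMap φ k (ins x f)` holds by definition. -/
def tailMap {a : ℕ} (φ : CL F L M (a + 1) →ₗ[F] CL F L M a) :
    ∀ k : ℕ, CL F L M (a + k + 1) →ₗ[F] CL F L M (a + k)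
  | 0 => φ
  | k + 1 =>
    { toFun f := (tailMap φ k ∘ₗ f.curryLeft).uncurryLeft
      map_add' f f' := by
        refine ext_ins fun x => ?_
        change tailMap φ k (ins x (f + f')) = tailMap φ k (ins x f) + tailMap φ k (ins x f')
        simp only [map_add]
      map_smul' c f := by
        refine ext_ins fun x => ?_
        change tailMap φ k (ins x (c • f)) = c • tailMap φ k (ins x f)
        simp only [map_smul] }

/-- A cochain is alternating in its first `p` arguments. Only equality of neighbouring arguments is
tested; if there are fewer than `p` arguments, all of them are meant. -/
def IsAltFirst : ℕ → ∀ {n : ℕ}, CL F L M n → Prop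
  | p + 2, _ + 2, f => (∀ x, ins x (ins x f) = 0) ∧ ∀ x, IsAltFirst (p + 1) (ins x f)
  | _, _, _ => True

lemma isAltFirst_one {n : ℕ} (f : CL F L M n) : IsAltFirst 1 f := by
  simp [IsAltFirst]

lemma IsAltFirst.ins {p n : ℕ} {f : CL F L M (n + 1)} (h : IsAltFirst (p + 1) f) (x : L) :
    IsAltFirst p (ins x f) := by
  match p, n, f, h with
  | 0, _, _, _ => simp [IsAltFirst]
  | p + 1, 0, _, _ => simp [IsAltFirst]
  | _ + 1, _ + 1, _, h => exact h.2 x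

lemma IsAltFirst.sub {p n : ℕ} {f f' : CL F L M n} (h : IsAltFirst p f) (h' : IsAltFirst p f') :
    IsAltFirst p (f - f') := by
  induction p, f using IsAltFirst.induct with
  | case1 p n f ih =>
    refine ⟨fun x => ?_, fun x => ?_⟩
    · simp only [map_sub, h.1 x, h'.1 x, sub_zero]
    · rw [map_sub]
      exact ih x (h.2 x) (h'.2 x)
  | case2 p f hpn =>
    rw [IsAltFirst]
    · trivial
    · rintro _ _ _ rfl rfl -
      exact hpn _ _ _ rfl rfl HEq.rfl

lemma IsAltFirst.smul {p n : ℕ} {f : CL F L M n} (c : ℤ) (h : IsAltFirst p f) :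
    IsAltFirst p (c • f) := by
  induction p, f using IsAltFirst.induct with
  | case1 p n f ih =>
    refine ⟨fun x => ?_, fun x => ?_⟩
    · simp only [map_zsmul, h.1 x, smul_zero]
    · rw [map_zsmul]
      exact ih x (h.2 x)
  | case2 p f hpn =>
    rw [IsAltFirst]
    · trivial
    · rintro _ _ _ rfl rfl -
      exact hpn _ _ _ rfl rfl HEq.rfl

lemma IsAltFirst.tailMap {a k p : ℕ} (φ : CL F L M (a + 1) →ₗ[F] CL F L M a) (hp : p ≤ k)
    {f : CL F L M (a + k + 1)} (h : IsAltFirst p f) : IsAltFirst p (tailMap φ k f) := by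
  induction k generalizing p with
  | zero =>
    obtain rfl : p = 0 := by omega
    simp [IsAltFirst]
  | succ k ih =>
    match p, h with
    | 0, _ => simp [IsAltFirst]
    | 1, _ => exact isAltFirst_one _
    | p + 2, h =>
      obtain ⟨k, rfl⟩ : ∃ l, k = l + 1 := ⟨k - 1, by omega⟩
      refine ⟨fun x => ?_, fun x => ?_⟩
      · exact (congrArg (LeibnizCoh.tailMap φ k) (h.1 x)).trans (map_zero _)
      · exact ih (by omega) (h.2 x)

lemma isAltFirst_of_alternating {n : ℕ} (p : ℕ) (f : CL F L M n)
    (h : ∀ v i j, v i = v j → i ≠ j → f v = 0) : IsAltFirst p f := by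
  induction p, f using IsAltFirst.induct with
  | case1 p n f ih =>
    refine ⟨fun x => ?_, fun x => ih x fun v i j hv hij => ?_⟩
    · ext v
      exact h (Fin.cons x (Fin.cons x v)) 0 1 rfl (by simp)
    · exact h (Fin.cons x v) i.succ j.succ (by simpa using hv) (by simpa using hij)
  | case2 p f hpn =>
    rw [IsAltFirst]
    · trivial
    · rintro _ _ _ rfl rfl -
      exact hpn _ _ _ rfl rfl HEq.rfl

/-- A cochain that vanishes if two neighbouring arguments are equal is alternating. -/
lemma IsAltFirst.alternating {n : ℕ} {f : CL F L M n} (hf : IsAltFirst n f) :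
    ∀ v i j, v i = v j → i ≠ j → f v = 0 := by
  induction n with
  | zero => exact fun v i => i.elim0
  | succ n ih =>
    have key : ∀ v, ∀ i j : Fin (n + 1), i < j → v i = v j → f v = 0 := by
      intro v i j hij hv
      rw [← Fin.cons_self_tail v] at hv ⊢
      generalize v 0 = a at *
      generalize Fin.tail v = w at *
      obtain ⟨j, rfl⟩ := Fin.exists_succ_eq.2 (Fin.ne_zero_of_lt hij)
      rw [← ins_apply]
      rcases Fin.eq_zero_or_eq_succ i with rfl | ⟨i, rfl⟩
      · obtain ⟨n, rfl⟩ : ∃ k, n = k + 1 := ⟨n - 1, by have := j.2; omega⟩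
        rw [← Fin.cons_self_tail w] at hv ⊢
        generalize w 0 = b at *
        generalize Fin.tail w = u at *
        rw [← ins_apply]
        rcases Fin.eq_zero_or_eq_succ j with rfl | ⟨j, rfl⟩
        · obtain rfl : a = b := by simpa using hv
          rw [hf.1 a]
          rfl
        · -- after exchanging the first two arguments, equal arguments occur behind the first one
          rw [eq_neg_of_add_eq_zero_left (ins_ins_swap hf.1 b a), neg_apply, neg_eq_zero,
            ins_apply]
          exact ih (hf.2 b) _ 0 j.succ (by simpa using hv) (Fin.succ_ne_zero j).symm
      · exact ih (hf.ins a) w i j (by simpa using hv) (by rintro rfl; exact lt_irrefl _ hij)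
    intro v i j hv hij
    rcases lt_or_gt_of_ne hij with h | h
    · exact key v i j h hv
    · exact key v j i h hv.symm

end Insertion

/-! ### Lie derivative and Cartan's formula -/

section Cartan

variable {F g M : Type*} [Field F] [LieRing g] [LieAlgebra F g]
  [AddCommGroup M] [Module F M] [LieRingModule g M] [LieModule F g M]

/-- The Lie derivative: the action of `x` on the cochains, regarded as linear maps
`g^{⊗ n} → M`. It is determined by its value in degree `0` and `ins_lieDer`. -/
def lieDer (x : g) : ∀ {n : ℕ}, CL F g M n →ₗ[F] CL F g M n
  | 0 =>
    { toFun f := (LieModule.toEnd F g M x).compMultilinearMap f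
      map_add' f f' := by ext; simp
      map_smul' c f := by ext; simp }
  | n + 1 =>
    { toFun f := (lieDer x ∘ₗ f.curryLeft
        - f.curryLeft ∘ₗ (LieModule.toEnd F g g x)).uncurryLeft
      map_add' f f' := by
        refine ext_ins fun y => ?_
        change lieDer x (ins y (f + f')) - ins ⁅x, y⁆ (f + f')
          = (lieDer x (ins y f) - ins ⁅x, y⁆ f) + (lieDer x (ins y f') - ins ⁅x, y⁆ f')
        simp only [map_add]
        abel
      map_smul' c f := by
        refine ext_ins fun y => ?_
        change lieDer x (ins y (c • f)) - ins ⁅x, y⁆ (c • f)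
          = c • (lieDer x (ins y f) - ins ⁅x, y⁆ f)
        simp only [map_smul, smul_sub] }

lemma ins_lieDer {n : ℕ} (x y : g) (f : CL F g M (n + 1)) :
    ins y (lieDer x f) = lieDer x (ins y f) - ins ⁅x, y⁆ f := rfl

lemma lieDer_apply {n : ℕ} (x : g) (f : CL F g M n) (v : Fin n → g) :
    lieDer x f v = ⁅x, f v⁆ - ∑ j, f (Function.update v j ⁅x, v j⁆) := by
  induction n with
  | zero => simp [lieDer]
  | succ n ih =>
    rw [← Fin.cons_self_tail v]
    generalize v 0 = a
    generalize Fin.tail v = w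
    rw [← ins_apply, ins_lieDer, sub_apply, ih, Fin.sum_univ_succ]
    simp only [ins_apply, Fin.cons_zero, Fin.cons_succ, Fin.update_cons_zero, Fin.cons_update]
    abel

lemma lieDer_lie {n : ℕ} (x y : g) (f : CL F g M n) :
    lieDer ⁅x, y⁆ f = lieDer x (lieDer y f) - lieDer y (lieDer x f) := by
  induction n with
  | zero => ext v; simp [lieDer_apply]
  | succ n ih =>
    refine ext_ins fun z => ?_
    rw [map_sub]
    simp only [ins_lieDer, map_sub, ih, lie_lie, ins_sub_left]
    abel

lemma IsAltFirst.lieDer {p n : ℕ} {f : CL F g M n} (h : IsAltFirst p f) (x : g) :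
    IsAltFirst p (lieDer x f) := by
  induction p, f using IsAltFirst.induct with
  | case1 p n f ih =>
    refine ⟨fun y => ?_, fun y => ?_⟩
    · rw [ins_lieDer, map_sub, ins_lieDer, h.1 y, map_zero, zero_sub, sub_eq_add_neg, ← neg_add,
        ins_ins_swap h.1, neg_zero]
    · rw [ins_lieDer]
      exact (ih y (h.2 y)).sub (h.2 _)
  | case2 p f hpn =>
    rw [IsAltFirst]
    · trivial
    · rintro _ _ _ rfl rfl -
      exact hpn _ _ _ rfl rfl HEq.rfl

variable (F g M) in
/-- The coboundary of the Leibniz complex of the symmetric bimodule `M_s`. -/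
abbrev dSymm (n : ℕ) : CL F g M n →ₗ[F] CL F g M (n + 1) :=
  dLeibniz (symmBimodule F g M) n

/-- For a symmetric bimodule the last argument acts in the same way as the others. -/
lemma dSymm_apply {n : ℕ} (f : CL F g M n) (v : Fin (n + 1) → g) :
    dSymm F g M n f v = (∑ i : Fin (n + 1), (-1 : ℤ) ^ (i : ℕ) • ⁅v i, f (i.removeNth v)⁆)
      + ∑ i : Fin (n + 1), ∑ j ∈ Finset.Ioi i, (-1 : ℤ) ^ ((i : ℕ) + 1) •
        f (i.removeNth (Function.update v j ⁅v i, v j⁆)) := by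
  change dLeibnizFun (symmBimodule F g M) f v = _
  rw [Fin.sum_univ_castSucc, dLeibnizFun]
  congr 2
  simp [symmBimodule, pow_succ]

/-- Cartan's formula in degree `0`. -/
lemma ins_dSymm_zero (x : g) (f : CL F g M 0) : ins x (dSymm F g M 0 f) = lieDer x f := by
  ext v
  rw [ins_apply, dSymm_apply, lieDer_apply]
  simp [Subsingleton.elim _ v]

/-- Cartan's formula. -/
lemma ins_dSymm {n : ℕ} (x : g) (f : CL F g M (n + 1)) :
    ins x (dSymm F g M (n + 1) f) = lieDer x f - dSymm F g M n (ins x f) := by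
  ext v
  rw [ins_apply, sub_apply, dSymm_apply, dSymm_apply, lieDer_apply, Fin.sum_univ_succ,
    Fin.sum_univ_succ (n := n + 1)]
  have h0 : ∀ u : Fin (n + 1) → g,
      (0 : Fin (n + 2)).removeNth (α := fun _ => g) (Fin.cons x u) = u :=
    fun u => funext fun k => by simp [Fin.removeNth_apply]
  have hs : ∀ (i : Fin (n + 1)) (u : Fin (n + 1) → g),
      i.succ.removeNth (α := fun _ => g) (Fin.cons x u)
        = (Fin.cons x (i.removeNth u) : Fin (n + 1) → g) := by
    intro i u
    funext k
    refine Fin.cases ?_ (fun k => ?_) k <;> simp [Fin.removeNth_apply]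
  simp only [ins_apply, Fin.cons_zero, Fin.cons_succ, h0, hs, ← Fin.map_succEmb_Ioi,
    Fin.Ioi_zero_eq_map, Finset.sum_map, Fin.coe_succEmb, ← Fin.cons_update, Fin.val_succ,
    Fin.val_zero, pow_succ, pow_zero, mul_neg_one, one_smul, neg_smul, Finset.sum_neg_distrib]
  abel

lemma ins_ins_dSymm {n : ℕ} (x : g) (f : CL F g M (n + 2)) :
    ins x (ins x (dSymm F g M (n + 2) f)) = dSymm F g M n (ins x (ins x f)) := by
  rw [ins_dSymm, map_sub, ins_dSymm, ins_lieDer, lie_self]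
  have : ins (0 : g) f = 0 := f.curryLeft.map_zero
  rw [this]
  abel

lemma dSymm_lieDer {n : ℕ} (x : g) (f : CL F g M n) :
    dSymm F g M n (lieDer x f) = lieDer x (dSymm F g M n f) := by
  induction n with
  | zero =>
    refine ext_ins fun y => ?_
    rw [ins_lieDer]
    simp only [ins_dSymm_zero, lieDer_lie]
    abel
  | succ n ih =>
    refine ext_ins fun y => ?_
    rw [ins_lieDer]
    simp only [ins_dSymm, lieDer_lie, ins_lieDer, map_sub, ih]
    abel

lemma dSymm_dSymm {n : ℕ} (f : CL F g M n) : dSymm F g M (n + 1) (dSymm F g M n f) = 0 := by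
  induction n with
  | zero =>
    refine ext_ins fun x => ?_
    rw [ins_dSymm, ins_dSymm_zero, dSymm_lieDer, sub_self, map_zero]
  | succ n ih =>
    refine ext_ins fun x => ?_
    rw [ins_dSymm, ins_dSymm, map_sub, ih, dSymm_lieDer, sub_zero, sub_self, map_zero]

end Cartan

/-! ### Inclusion of the Chevalley–Eilenberg cochains -/

section Inclusion

variable {F g M : Type*} [Field F] [LieRing g] [LieAlgebra F g] [AddCommGroup M] [Module F M]

variable (F g M) in
/-- The inclusion of the Chevalley–Eilenberg cochains into the Leibniz cochains. -/
def ceIncl (n : ℕ) : CE F g M n →ₗ[F] CL F g M n := AlternatingMap.toMultilinearMapLM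

lemma ceIncl_injective (n : ℕ) : Function.Injective (ceIncl F g M n) :=
  AlternatingMap.coe_multilinearMap_injective

lemma isAltFirst_ceIncl {n : ℕ} (p : ℕ) (c : CE F g M n) : IsAltFirst p (ceIncl F g M n c) :=
  isAltFirst_of_alternating p _ fun v _ _ hv hij => c.map_eq_zero_of_eq v hv hij

lemma IsAltFirst.mem_range_ceIncl {n : ℕ} {f : CL F g M n} (hf : IsAltFirst n f) :
    f ∈ LinearMap.range (ceIncl F g M n) :=
  ⟨{ f with map_eq_zero_of_eq' := hf.alternating }, rfl⟩

end Inclusion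

/-! ### Making a cochain alternating up to coboundaries -/

section Comparison

variable {F g M : Type*} [Field F] [LieRing g] [LieAlgebra F g]
  [AddCommGroup M] [Module F M] [LieRingModule g M] [LieModule F g M]

/-- The hypotheses of the induction step pass from `f` to `ins x f`, with `p` lowered by one: by
Cartan's formula `d (ins x f) = lieDer x f - ins x (d f)`. -/
lemma isAltFirst_dSymm_ins {n p : ℕ} {f : CL F g M (n + 1)} (hf : IsAltFirst p f)
    (hdf : IsAltFirst (p + 1) (dSymm F g M (n + 1) f)) (x : g) :
    IsAltFirst p (dSymm F g M n (ins x f)) := by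
  rw [← sub_sub_cancel (lieDer x f) (dSymm F g M n (ins x f)), ← ins_dSymm]
  exact (hf.lieDer x).sub (hdf.ins x)

/-- The induction step for cochains without arguments behind the first `p + 2`: the values on equal
neighbours are cocycles of degree `0`, hence zero, and no correction by a coboundary is needed. -/
lemma isAltFirst_succ_of_degree_zero_tail {p : ℕ}
    (hz : ∀ z : CL F g M 0, dSymm F g M 0 z = 0 → z = 0)
    {f : CL F g M (p + 2)} (hf : IsAltFirst (p + 1) f)
    (hdf : IsAltFirst (p + 2) (dSymm F g M (p + 2) f)) : IsAltFirst (p + 2) f := by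
  induction p with
  | zero =>
    refine ⟨fun x => hz _ ?_, fun x => isAltFirst_one _⟩
    rw [← ins_ins_dSymm]
    exact hdf.1 x
  | succ p ih =>
    exact ⟨hf.1, fun x => ih (hf.2 x) (isAltFirst_dSymm_ins hf hdf x)⟩

/-- The induction step for cochains with `q + 1` arguments behind the first `p + 2`: a cochain that
is alternating in the first `p + 1` arguments becomes alternating in `p + 2` arguments after
subtraction of a coboundary. The sign arises as `ins x` anticommutes with the coboundary up to
`lieDer x`, once for each of the first `p` arguments. -/
lemma isAltFirst_succ_sub {q p : ℕ} {s : CL F g M (q + 1) →ₗ[F] CL F g M q}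
    (hs : ∀ z, dSymm F g M (q + 1) z = 0 → dSymm F g M q (s z) = z)
    {f : CL F g M (q + (p + 2) + 1)} (hf : IsAltFirst (p + 1) f)
    (hdf : IsAltFirst (p + 2) (dSymm F g M (q + (p + 2) + 1) f)) :
    IsAltFirst (p + 2)
      (f - (-1 : ℤ) ^ p • dSymm F g M (q + (p + 2)) (tailMap s (p + 2) f)) := by
  induction p with
  | zero =>
    refine ⟨fun x => ?_, fun x => isAltFirst_one _⟩
    have h : dSymm F g M (q + 1) (ins x (ins x f)) = 0 := by
      rw [← ins_ins_dSymm]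
      exact hdf.1 x
    rw [pow_zero, one_smul, map_sub, map_sub, ins_ins_dSymm, sub_eq_zero]
    exact (hs _ h).symm
  | succ p ih =>
    refine ⟨fun x => ?_, fun x => ?_⟩
    · have h : ins x (ins x (dSymm F g M (q + (p + 1 + 2)) (tailMap s (p + 1 + 2) f))) = 0 := by
        refine (ins_ins_dSymm (n := q + (p + 1)) x _).trans ?_
        change dSymm F g M (q + (p + 1)) (tailMap s (p + 1) (ins x (ins x f))) = 0
        rw [hf.1 x, map_zero, map_zero]
      rw [map_sub, map_sub, map_zsmul, map_zsmul, h, hf.1 x, smul_zero, sub_zero]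
    · have h := ih (hf.2 x) (isAltFirst_dSymm_ins hf hdf x)
      have hL : IsAltFirst (p + 2) (lieDer x (tailMap s (p + 1 + 2) f)) :=
        (hf.tailMap s (by omega)).lieDer x
      have hC : ins x (dSymm F g M (q + (p + 1 + 2)) (tailMap s (p + 1 + 2) f))
          = lieDer x (tailMap s (p + 1 + 2) f)
            - dSymm F g M (q + (p + 2)) (tailMap s (p + 2) (ins x f)) :=
        ins_dSymm (n := q + (p + 2)) x _
      have hsub : ∀ u v w : CL F g M (q + (p + 2) + 1), u - (-1 : ℤ) ^ (p + 1) • (v - w)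
          = u - (-1 : ℤ) ^ p • w - (-1 : ℤ) ^ (p + 1) • v := by
        intro u v w
        rw [pow_succ, mul_neg_one, neg_smul, neg_smul, smul_sub]
        abel
      rw [map_sub, map_zsmul, hC]
      exact Eq.mpr (congrArg (IsAltFirst (p + 2)) (hsub _ _ _))
        (h.sub (hL.smul ((-1 : ℤ) ^ (p + 1))))

/-- In a degree without cohomology there is a linear choice of primitives of cocycles. It is extended
to all cochains, so that it can be applied to values of cochains that need not be cocycles. -/
lemma exists_primitive {C : ℕ → Type*} [∀ n, AddCommGroup (C n)] [∀ n, Module F (C n)]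
    (d : ∀ n, C n →ₗ[F] C (n + 1)) (q : ℕ) (h : Subsingleton (Cohomology d (q + 1))) :
    ∃ s : C (q + 1) →ₗ[F] C q, ∀ z, d (q + 1) z = 0 → d q (s z) = z := by
  obtain ⟨t, ht⟩ := (d q).rangeRestrict.exists_rightInverse_of_surjective (d q).range_rangeRestrict
  obtain ⟨s, hs⟩ := t.exists_extend
  refine ⟨s, fun z hz => ?_⟩
  have hmem : z ∈ LinearMap.range (d q) := by
    have := Submodule.Quotient.subsingleton_iff.1 h
    have h1 : (⟨z, hz⟩ : LinearMap.ker (d (q + 1))) ∈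
      (coboundaries d (q + 1)).submoduleOf (LinearMap.ker (d (q + 1))) := this ▸ trivial
    exact h1
  have h1 := congrArg (fun φ => ((φ ⟨z, hmem⟩ : LinearMap.range (d q)) : C (q + 1))) ht
  have h2 := congrArg (fun φ => φ ⟨z, hmem⟩) hs
  simp only [LinearMap.comp_apply, Submodule.subtype_apply] at h1 h2
  rw [h2]
  exact h1

/-- A cochain of degree `m` with alternating coboundary is alternating up to a coboundary if
`HL^q(g, M_s) = 0` for `q + 2 ≤ m`. -/
lemma exists_sub_alternating {m : ℕ}
    (hHL : ∀ q, q + 2 ≤ m → Subsingleton (HL (symmBimodule F g M) q))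
    (f : CL F g M m) (hdf : ∀ p, IsAltFirst p (dSymm F g M m f)) :
    ∃ b ∈ coboundaries (dSymm F g M) m, IsAltFirst m (f - b) := by
  have main : ∀ p < m, ∃ b ∈ coboundaries (dSymm F g M) m, IsAltFirst (p + 1) (f - b) := by
    intro p
    induction p with
    | zero => exact fun _ => ⟨0, zero_mem _, isAltFirst_one _⟩
    | succ p ih =>
      intro hp
      obtain ⟨b, hb, hfb⟩ := ih (by omega)
      have hd : dSymm F g M m (f - b) = dSymm F g M m f := by
        rw [map_sub, sub_eq_self]
        cases m with
        | zero => omega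
        | succ m =>
          obtain ⟨u, rfl⟩ := hb
          exact dSymm_dSymm u
      have hdf' := hdf (p + 2)
      rw [← hd] at hdf'
      have hm : m = p + 2 ∨ ∃ q, m = q + (p + 2) + 1 := by
        by_cases h : m = p + 2
        · exact Or.inl h
        · exact Or.inr ⟨m - (p + 3), by omega⟩
      rcases hm with rfl | ⟨q, rfl⟩
      · refine ⟨b, hb, isAltFirst_succ_of_degree_zero_tail (fun z hz => ?_) hfb hdf'⟩
        have h := Submodule.Quotient.subsingleton_iff.1 (hHL 0 (by omega))
        have hz' : (⟨z, hz⟩ : LinearMap.ker (dSymm F g M 0)) ∈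
          (coboundaries (dSymm F g M) 0).submoduleOf _ := h ▸ trivial
        exact hz'
      · obtain ⟨s, hs⟩ := exists_primitive (dSymm F g M) q (hHL (q + 1) (by omega))
        refine ⟨b + (-1 : ℤ) ^ p • dSymm F g M _ (tailMap s (p + 2) (f - b)),
          add_mem hb (zsmul_mem (LinearMap.mem_range_self _ _) _), ?_⟩
        rw [← sub_sub]
        exact isAltFirst_succ_sub hs hfb hdf'
  cases m with
  | zero => exact ⟨0, zero_mem _, by simp [IsAltFirst]⟩
  | succ m => exact main m (by omega)

lemma dSymm_ceIncl (n : ℕ) (c : CE F g M n) :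
    dSymm F g M n (ceIncl F g M n c) = ceIncl F g M (n + 1) (dCE F g M n c) := by
  ext v
  rw [dSymm_apply]
  change _ = ceAction c v + ceBracket c v
  rw [ceBracket_eq]
  rfl

end Comparison

/-! ### Injective chain maps with acyclic cokernel -/

section ChainMap

variable {F : Type*} [Field F] {C D : ℕ → Type*} [∀ n, AddCommGroup (C n)] [∀ n, Module F (C n)]
  [∀ n, AddCommGroup (D n)] [∀ n, Module F (D n)]
  {c : ∀ n, C n →ₗ[F] C (n + 1)} {d : ∀ n, D n →ₗ[F] D (n + 1)} {φ : ∀ n, C n →ₗ[F] D n}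

/-- The map induced on cohomology by a chain map. -/
def cohomologyMap (hφ : ∀ n x, d n (φ n x) = φ (n + 1) (c n x)) (n : ℕ) :
    Cohomology c n →ₗ[F] Cohomology d n :=
  Submodule.mapQ _ _ ((φ n).restrict (p := LinearMap.ker (c n)) (q := LinearMap.ker (d n))
    fun x hx => by rw [LinearMap.mem_ker] at hx ⊢; rw [hφ, hx, map_zero]) <| by
    rintro ⟨x, hx⟩ hxb
    change x ∈ coboundaries c n at hxb
    change φ n x ∈ coboundaries d n
    cases n with
    | zero =>
      obtain rfl : x = 0 := hxb
      exact map_zero _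
    | succ n =>
      obtain ⟨u, rfl⟩ := hxb
      exact ⟨φ n u, hφ n u⟩

/-- The cokernel of the chain map `φ` has no cohomology in degree `m`, in terms of
representatives: every `f` whose coboundary lies in the image of `φ` lies in this image up to a
coboundary. -/
def CokerAcyclicAt (d : ∀ n, D n →ₗ[F] D (n + 1)) (φ : ∀ n, C n →ₗ[F] D n) (m : ℕ) : Prop :=
  ∀ f : D m, d m f ∈ LinearMap.range (φ (m + 1)) →
    ∃ b ∈ coboundaries d m, f - b ∈ LinearMap.range (φ m)

lemma d_eq_zero_of_mem_coboundaries (hd : ∀ n x, d (n + 1) (d n x) = 0) {m : ℕ} {b : D m}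
    (hb : b ∈ coboundaries d m) : d m b = 0 := by
  cases m with
  | zero =>
    obtain rfl : b = 0 := hb
    exact map_zero _
  | succ m =>
    obtain ⟨u, rfl⟩ := hb
    exact hd m u

lemma cohomologyMap_surjective (hφ : ∀ n x, d n (φ n x) = φ (n + 1) (c n x))
    (hinj : ∀ n, Function.Injective (φ n)) (hd : ∀ n x, d (n + 1) (d n x) = 0) {m : ℕ}
    (h : CokerAcyclicAt d φ m) : Function.Surjective (cohomologyMap hφ m) := by
  intro ζ
  obtain ⟨⟨z, hz⟩, rfl⟩ := Submodule.Quotient.mk_surjective _ ζ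
  rw [LinearMap.mem_ker] at hz
  obtain ⟨b, hb, x, hx⟩ := h z (hz ▸ zero_mem _)
  have hx0 : c m x = 0 := by
    apply hinj
    rw [← hφ, hx, map_sub, hz, d_eq_zero_of_mem_coboundaries hd hb, sub_zero, map_zero]
  refine ⟨Submodule.Quotient.mk ⟨x, hx0⟩, (Submodule.Quotient.eq _).2 ?_⟩
  change φ m x - z ∈ coboundaries d m
  rw [hx, sub_sub_cancel_left]
  exact neg_mem hb

lemma cohomologyMap_injective (hφ : ∀ n x, d n (φ n x) = φ (n + 1) (c n x))
    (hinj : ∀ n, Function.Injective (φ n)) (hd : ∀ n x, d (n + 1) (d n x) = 0) {m : ℕ}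
    (h : CokerAcyclicAt d φ m) : Function.Injective (cohomologyMap hφ (m + 1)) := by
  rw [injective_iff_map_eq_zero]
  intro ζ hζ
  obtain ⟨⟨z, hz⟩, rfl⟩ := Submodule.Quotient.mk_surjective _ ζ
  obtain ⟨u, hu⟩ : φ (m + 1) z ∈ coboundaries d (m + 1) :=
    (Submodule.Quotient.mk_eq_zero
      ((coboundaries d (m + 1)).submoduleOf (LinearMap.ker (d (m + 1))))).1 hζ
  obtain ⟨b, hb, x, hx⟩ := h u ⟨z, hu.symm⟩
  refine (Submodule.Quotient.mk_eq_zero _).2 ⟨x, hinj _ ?_⟩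
  rw [← hφ, hx, map_sub, d_eq_zero_of_mem_coboundaries hd hb, sub_zero, hu]
  rfl

end ChainMap

/-! ### Comparison of the cohomologies -/

section LowDegrees

variable {F g M : Type*} [Field F] [LieRing g] [LieAlgebra F g]
  [AddCommGroup M] [Module F M] [LieRingModule g M] [LieModule F g M]

variable (F g M) in
/-- The homomorphism `H^m(g, M) → HL^m(g, M_s)` induced by the inclusion of cochains. -/
def toHL (m : ℕ) : H F g M m →ₗ[F] HL (symmBimodule F g M) m :=
  cohomologyMap (c := dCE F g M) (d := dSymm F g M) (φ := ceIncl F g M)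
    dSymm_ceIncl m

lemma cokerAcyclicAt_ceIncl {m : ℕ}
    (hHL : ∀ q, q + 2 ≤ m → Subsingleton (HL (symmBimodule F g M) q)) :
    CokerAcyclicAt (dSymm F g M) (ceIncl F g M) m := by
  rintro f ⟨c, hc⟩
  obtain ⟨b, hb, hfb⟩ := exists_sub_alternating hHL f fun p => hc ▸ isAltFirst_ceIncl p c
  exact ⟨b, hb, hfb.mem_range_ceIncl⟩

lemma toHL_surjective {m : ℕ}
    (hHL : ∀ q, q + 2 ≤ m → Subsingleton (HL (symmBimodule F g M) q)) :
    Function.Surjective (toHL F g M m) :=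
  cohomologyMap_surjective (c := dCE F g M) (d := dSymm F g M) (φ := ceIncl F g M)
    dSymm_ceIncl ceIncl_injective (fun _ => dSymm_dSymm)
    (cokerAcyclicAt_ceIncl hHL)

lemma toHL_injective {m : ℕ}
    (hHL : ∀ q, q + 2 ≤ m → Subsingleton (HL (symmBimodule F g M) q)) :
    Function.Injective (toHL F g M (m + 1)) :=
  cohomologyMap_injective (c := dCE F g M) (d := dSymm F g M) (φ := ceIncl F g M)
    dSymm_ceIncl ceIncl_injective (fun _ => dSymm_dSymm)
    (cokerAcyclicAt_ceIncl hHL)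

lemma subsingleton_HL {n : ℕ} (hH : ∀ k ≤ n, Subsingleton (H F g M k)) :
    ∀ k ≤ n, Subsingleton (HL (symmBimodule F g M) k) := by
  intro k
  induction k using Nat.strong_induction_on with
  | _ k ih =>
    intro hk
    have := hH k hk
    exact (toHL_surjective fun q hq => ih q (by omega) (by omega)).subsingleton

end LowDegrees

end LeibnizCoh

theorem theorem2p4 {F g M : Type*} [Field F] [LieRing g] [LieAlgebra F g]
    [AddCommGroup M] [Module F M] [LieRingModule g M] [LieModule F g M] :
    (∀ n : ℕ, (∀ k ≤ n, Subsingleton (LeibnizCoh.H F g M k)) →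
      (∀ k ≤ n, Subsingleton (LeibnizCoh.HL (LeibnizCoh.symmBimodule F g M) k)) ∧
      Nonempty (LeibnizCoh.HL (LeibnizCoh.symmBimodule F g M) (n + 1) ≃ₗ[F]
        LeibnizCoh.H F g M (n + 1)) ∧
      Nonempty (LeibnizCoh.HL (LeibnizCoh.symmBimodule F g M) (n + 2) ≃ₗ[F]
        LeibnizCoh.H F g M (n + 2))) ∧
    ((∀ k : ℕ, Subsingleton (LeibnizCoh.H F g M k)) →
      ∀ k : ℕ, Subsingleton (LeibnizCoh.HL (LeibnizCoh.symmBimodule F g M) k)) := by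
  refine ⟨fun n hH => ?_, fun hH k => LeibnizCoh.subsingleton_HL (fun j _ => hH j) k le_rfl⟩
  have hHL := LeibnizCoh.subsingleton_HL hH
  refine ⟨hHL, ⟨(LinearEquiv.ofBijective (LeibnizCoh.toHL F g M (n + 1)) ⟨?_, ?_⟩).symm⟩,
    ⟨(LinearEquiv.ofBijective (LeibnizCoh.toHL F g M (n + 2)) ⟨?_, ?_⟩).symm⟩⟩
  · exact LeibnizCoh.toHL_injective fun q _ => hHL q (by omega)
  · exact LeibnizCoh.toHL_surjective fun q _ => hHL q (by omega)
  · exact LeibnizCoh.toHL_injective fun q _ => hHL q (by omega)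
  · exact LeibnizCoh.toHL_surjective fun q _ => hHL q (by omega)
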